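/- Let $\mathbb N=\{1,2,\dots\}$. For finite $E,F\subset\mathbb N$ and $n\in\mathbb N$ write $E<F$ if $\max E<\min F$ and $n\leqslant E$ if $n\leqslant\min E$, with $\min\varnothing=\infty$. For families $\mathcal F,\mathcal G$ of finite subsets of $\mathbb N$ let $$\mathcal F[\mathcal G]=\Bigl\{\bigcup_{i=1}^nE_i:\ n\geqslant 0,\ E_1<\dots<E_n,\ \varnothing\neq E_i\in\mathcal G,\ \{\min E_i: 1\leqslant i\leqslant n\}\in\mathcal F\Bigr\}.$$ Fix for every countable limit ordinal $\lambda$ a non-decreasing sequence $(\lambda_n)_{n\in\mathbb N}$ of ordinals $\lambda_n<\lambda$ with $\sup_n\lambda_n=\lambda$. The Schreier families are defined by $\mathcal S_0=\{\varnothing\}\cup\{\{n\}:n\in\mathbb N\}$, $\mathcal S_1=\{E:|E|\leqslant\min E\}$, $\mathcal S_{\xi+1}=\mathcal S_1[\mathcal S_\xi]$, and $\mathcal S_\lambda=\{E:\ \exists n\in\mathbb N,\ n\leqslant E\in\mathcal S_{\lambda_n}\}$ for countable limit ordinals $\lambda$. For $\zeta<\omega_1$, a Banach space $Z$ (real or complex)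 is said to contain an $\ell_1^{\zeta}$ spreading model if there are a basic sequence $(x_i)_{i\in\mathbb N}$ in $Z$ (that is, a sequence which is a Schauder basis of its closed linear span) and constants $c,C>0$ such that $$c^{-1}\sum_{i\in E}|a_i|\leqslant\Bigl\|\sum_{i\in E}a_ix_i\Bigr\|\leqslant C\sum_{i\in E}|a_i|\qquad\text{for all }E\in\mathcal S_\zeta\text{ and all scalars }(a_i)_{i\in E}.$$ **Proposition (three-space property).** Let $X$ be a Banach space, $Y$ a closed subspace of $X$, and $\xi<\omega_1$. Then $X$ contains an $\ell_1^{\omega^\xi}$ spreading model if and only if $Y$ or $X/Y$ contains an $\ell_1^{\omega^\xi}$ spreading model. -/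

import Mathlib

/-- The family `𝓕[𝓖]`: all unions `E₁ ∪ … ∪ Eₙ` of successive non-empty members `E₁ < … < Eₙ`
of `𝓖` such that `{min E₁, …, min Eₙ}` belongs to `𝓕` (`n = 0` gives the empty set). -/
def convolution (F G : Set (Finset ℕ+)) : Set (Finset ℕ+) :=
  {E | ∃ (n : ℕ) (A : Fin n → Finset ℕ+) (hne : ∀ i, (A i).Nonempty),
    (∀ i, A i ∈ G) ∧
    (∀ i j, i < j → ∀ a ∈ A i, ∀ b ∈ A j, a < b) ∧
    Finset.univ.image (fun i => (A i).min' (hne i)) ∈ F ∧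
    E = Finset.univ.biUnion A}

/-- `𝓢₀`: the empty set and the singletons. -/
def schreierZero : Set (Finset ℕ+) := {E | E = ∅ ∨ ∃ n, E = {n}}

/-- `𝓢₁`: the finite sets `E` with `|E| ≤ min E` (the minimum of the empty set being infinite). -/
def schreierOne : Set (Finset ℕ+) := {E | ∀ i ∈ E, E.card ≤ (i : ℕ)}

/-- A choice, for every countable limit ordinal `o`, of a sequence of ordinals
`s o 1 ≤ s o 2 ≤ …` below `o` with supremum `o`. -/
def IsLimitApproximation (s : Ordinal.{0} → ℕ+ → Ordinal.{0}) : Prop :=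
  ∀ o, Order.IsSuccLimit o → o < Ordinal.omega 1 →
    (∀ n, s o n < o) ∧ Monotone (s o) ∧ IsLUB (Set.range (s o)) o

/-- The Schreier families `𝓢_ξ` built along the choice `s` of approximating sequences:
`𝓢_{ξ+1} = 𝓢₁[𝓢_ξ]`, and for a limit ordinal `ξ` the family `𝓢_ξ` consists of those `E` for which
there is `n ≤ E` with `E ∈ 𝓢_{s ξ n}`. -/
noncomputable def schreier (s : Ordinal.{0} → ℕ+ → Ordinal.{0}) (ξ : Ordinal.{0}) :
    Set (Finset ℕ+) :=
  Ordinal.limitRecOn (motive := fun _ => Set (Finset ℕ+)) ξ schreierZero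
    (fun _ S => convolution schreierOne S)
    (fun o _ S => {E | ∃ n : ℕ+, ∃ h : s o n < o, (∀ i ∈ E, n ≤ i) ∧ E ∈ S (s o n) h})

theorem schreier_zero (s : Ordinal.{0} → ℕ+ → Ordinal.{0}) : schreier s 0 = schreierZero :=
  Ordinal.limitRecOn_zero _ _ _

theorem schreier_add_one (s : Ordinal.{0} → ℕ+ → Ordinal.{0}) (ξ : Ordinal.{0}) :
    schreier s (ξ + 1) = convolution schreierOne (schreier s ξ) :=
  Ordinal.limitRecOn_add_one _ _ _ _

theorem schreier_limit (s : Ordinal.{0} → ℕ+ → Ordinal.{0}) (hs : IsLimitApproximation s)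
    (ξ : Ordinal.{0}) (hξ : Order.IsSuccLimit ξ) (hξ' : ξ < Ordinal.omega 1) :
    schreier s ξ = {E | ∃ n : ℕ+, (∀ i ∈ E, n ≤ i) ∧ E ∈ schreier s (s ξ n)} := by
  have h := Ordinal.limitRecOn_limit (motive := fun _ => Set (Finset ℕ+)) ξ schreierZero
    (fun _ S => convolution schreierOne S)
    (fun o _ S => {E | ∃ n : ℕ+, ∃ h : s o n < o, (∀ i ∈ E, n ≤ i) ∧ E ∈ S (s o n) h}) hξ
  refine h.trans ?_
  ext E
  exact ⟨fun ⟨n, _, h1, h2⟩ => ⟨n, h1, h2⟩, fun ⟨n, h1, h2⟩ => ⟨n, (hs ξ hξ hξ').1 n, h1, h2⟩⟩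

/-- The successor step at `0` gives the explicit family `𝓢₁`. -/
theorem schreier_one (s : Ordinal.{0} → ℕ+ → Ordinal.{0}) : schreier s 1 = schreierOne := by
  have h1 : schreier s 1 = convolution schreierOne schreierZero := by
    rw [← schreier_zero s, ← schreier_add_one, zero_add]
  rw [h1]
  ext E
  constructor
  · rintro ⟨n, A, hne, hA, -, hF, rfl⟩
    have hb : Finset.univ.biUnion A = Finset.univ.image (fun i => (A i).min' (hne i)) := by
      ext x
      simp only [Finset.mem_biUnion, Finset.mem_image, Finset.mem_univ, true_and]
      refine exists_congr fun i => ?_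
      rcases hA i with h | ⟨m, hm⟩
      · exact absurd (hne i) (by simp [h])
      · simp [hm, eq_comm]
    rw [hb]
    exact hF
  · intro hE
    have hmin : ∀ i, ({E.orderEmbOfFin rfl i} : Finset ℕ+).min' (Finset.singleton_nonempty _) =
        E.orderEmbOfFin rfl i := fun i => Finset.min'_singleton _
    refine ⟨E.card, fun i => {E.orderEmbOfFin rfl i}, fun i => Finset.singleton_nonempty _,
      fun i => Or.inr ⟨_, rfl⟩, ?_, ?_, ?_⟩
    · intro i j hij a ha b hb
      rw [Finset.mem_singleton] at ha hb
      rw [ha, hb]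
      exact (E.orderEmbOfFin rfl).strictMono hij
    · simp only [hmin]
      have : Finset.univ.image (fun i => E.orderEmbOfFin rfl i) = E :=
        Finset.image_orderEmbOfFin_univ E rfl
      rw [this]
      exact hE
    · rw [Finset.biUnion_singleton]
      exact (Finset.image_orderEmbOfFin_univ E rfl).symm

/-- Approximating sequences for all countable limit ordinals can be chosen. -/
theorem exists_isLimitApproximation : ∃ s, IsLimitApproximation s := by
  have key : ∀ o : Ordinal.{0}, ∃ t : ℕ+ → Ordinal.{0}, Order.IsSuccLimit o →
      o < Ordinal.omega 1 → (∀ n, t n < o) ∧ Monotone t ∧ IsLUB (Set.range t) o := by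
    intro o
    by_cases h : Order.IsSuccLimit o ∧ o < Ordinal.omega 1
    · obtain ⟨ho, ho'⟩ := h
      have hc : Countable (Set.Iio o) := by
        rw [← Cardinal.mk_le_aleph0_iff, Cardinal.mk_Iio_ordinal, Cardinal.lift_le_aleph0,
          ← Order.lt_succ_iff, Cardinal.succ_aleph0, ← Cardinal.lt_ord, Cardinal.ord_aleph]
        exact ho'
      have hn : Nonempty (Set.Iio o) := ⟨⟨0, ho.bot_lt⟩⟩
      obtain ⟨t, ht, htt⟩ := Filter.exists_seq_monotone_tendsto_atTop_atTop (Set.Iio o)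
      refine ⟨fun n => (t n : Set.Iio o), fun _ _ => ⟨fun n => (t n).2,
        fun a b hab => ht (by exact_mod_cast hab), ?_, ?_⟩⟩
      · rintro _ ⟨n, rfl⟩
        exact (t n).2.le
      · intro b hb
        by_contra hbo
        have hbo : b < o := not_le.mp hbo
        have h2 := ho.succ_lt hbo
        obtain ⟨n, hn⟩ := ((Filter.tendsto_atTop.mp htt ⟨_, h2⟩).and
          (Filter.eventually_ge_atTop 1)).exists
        have h3 : (t n : Ordinal) ≤ b := hb ⟨⟨n, hn.2⟩, rfl⟩
        exact absurd ((Order.lt_succ b).trans_le (hn.1 : Order.succ b ≤ (t n : Ordinal)))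
          (not_lt.mpr h3)
    · exact ⟨fun _ => 0, fun h1 h2 => absurd ⟨h1, h2⟩ h⟩
  choose s hs using key
  exact ⟨s, hs⟩

/-- `(x₁, x₂, …)` is a basic sequence: a Schauder basis of its closed linear span. -/
def IsBasicSequence (𝕜 : Type*) [RCLike 𝕜] {X : Type*} [NormedAddCommGroup X] [NormedSpace 𝕜 X]
    (x : ℕ+ → X) : Prop :=
  ∃ b : SchauderBasis 𝕜 (Submodule.span 𝕜 (Set.range x)).topologicalClosure,
    ∀ n : ℕ, (b n : X) = x n.succPNat

/-- `(x₁, x₂, …)` is a `K`-`ℓ₁` spreading model with respect to the family `F` of finite sets. -/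
def IsL1SpreadingModel (𝕜 : Type*) [RCLike 𝕜] {X : Type*} [NormedAddCommGroup X]
    [NormedSpace 𝕜 X] (F : Set (Finset ℕ+)) (K : ℝ) (x : ℕ+ → X) : Prop :=
  IsBasicSequence 𝕜 x ∧ ∃ c C : ℝ, 0 < c ∧ 0 < C ∧ c * C ≤ K ∧
    ∀ E ∈ F, ∀ a : ℕ+ → 𝕜,
      c⁻¹ * ∑ i ∈ E, ‖a i‖ ≤ ‖∑ i ∈ E, a i • x i‖ ∧
      ‖∑ i ∈ E, a i • x i‖ ≤ C * ∑ i ∈ E, ‖a i‖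

/-- `X` contains an `ℓ₁` spreading model with respect to `F`, with some constant `K ≥ 1`. -/
def ContainsL1SpreadingModel (𝕜 : Type*) [RCLike 𝕜] (X : Type*) [NormedAddCommGroup X]
    [NormedSpace 𝕜 X] (F : Set (Finset ℕ+)) : Prop :=
  ∃ K : ℝ, 1 ≤ K ∧ ∃ x : ℕ+ → X, IsL1SpreadingModel 𝕜 F K x

/-! Write F for the Schreier family of index ω^ξ. Basicness and the upper estimate cost nothing:
from a bounded sequence with a lower ℓ₁ estimate on F, differences along a subsequence are basic by
Mazur's argument and keep a lower estimate (`HasLowerL1Estimate.containsL1SpreadingModel`). So only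
bounded sequences with lower estimates matter. These pass from Y to X by inclusion, and from X/Y to
X by bounded lifting.

For the converse, F is a union of layers G n, truncated at n. Since ω^ξ is additively
indecomposable, ζ + ω^ξ = ω^ξ for ζ < ω^ξ, so a union over J ∈ F of blocks from one layer, taken far
enough out, is again in F (`absorbsBlocks_schreier`, `IsLayered`). Let z in X have lower constant c.
Either some layer carries, arbitrarily far out, ℓ₁-normalised combinations of z at distance less
than c/2 from Y; successive ones, perturbed into Y, keep the lower constant c/2 on F. Or each layer
eventually has the lower estimate c/2 in X/Y, and a diagonal subsequence has it on all of F. -/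

/-- A sequence of non-empty finite sets `B 1 < B 2 < …`. -/
structure IsBlockSequence (B : ℕ+ → Finset ℕ+) : Prop where
  nonempty : ∀ j, (B j).Nonempty
  lt : ∀ i j, i < j → ∀ a ∈ B i, ∀ b ∈ B j, a < b

theorem IsBlockSequence.le {B : ℕ+ → Finset ℕ+} (hB : IsBlockSequence B) (j : ℕ+) :
    ∀ a ∈ B j, j ≤ a := by
  induction j using PNat.recOn with
  | one => exact fun a _ => one_le
  | succ n ih =>
    intro a ha
    obtain ⟨b, hb⟩ := hB.nonempty n
    exact PNat.add_one_le_iff.mpr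
      ((ih b hb).trans_lt (hB.lt n (n + 1) (PNat.lt_add_right n 1) b hb a ha))

theorem IsBlockSequence.pairwiseDisjoint {B : ℕ+ → Finset ℕ+} (hB : IsBlockSequence B)
    (s : Set ℕ+) : s.PairwiseDisjoint B := by
  intro i _ j _ hij
  refine Finset.disjoint_left.mpr fun a hi hj => ?_
  rcases lt_or_gt_of_ne hij with h | h
  · exact lt_irrefl _ (hB.lt i j h a hi a hj)
  · exact lt_irrefl _ (hB.lt j i h a hj a hi)

theorem StrictMono.le_apply_pnat {h : ℕ+ → ℕ+} (hh : StrictMono h) (n : ℕ+) : n ≤ h n := by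
  induction n using PNat.recOn with
  | one => exact one_le
  | succ n ih => exact PNat.add_one_le_iff.mpr (ih.trans_lt (hh (PNat.lt_add_right n 1)))

/-- The families `𝓕` with `h(E) ∈ 𝓕` for all `E ∈ 𝓕` and all strictly increasing `h`. -/
def IsSpreading (F : Set (Finset ℕ+)) : Prop :=
  ∀ E ∈ F, ∀ h : ℕ+ → ℕ+, StrictMono h → E.image h ∈ F

/-- The minima of n successive blocks are distinct, so they form a set in `schreierOne` exactly when
n is at most every element of every block. -/
theorem mem_convolution_schreierOne {G : Set (Finset ℕ+)} {E : Finset ℕ+} :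
    E ∈ convolution schreierOne G ↔ ∃ (n : ℕ) (A : Fin n → Finset ℕ+), (∀ i, (A i).Nonempty) ∧
      (∀ i, A i ∈ G) ∧ (∀ i j, i < j → ∀ a ∈ A i, ∀ b ∈ A j, a < b) ∧
      (∀ i, ∀ a ∈ A i, n ≤ (a : ℕ)) ∧ E = Finset.univ.biUnion A := by
  constructor
  · rintro ⟨n, A, hne, hG, hlt, hS, rfl⟩
    refine ⟨n, A, hne, hG, hlt, fun i a ha => ?_, rfl⟩
    have hinj : Function.Injective fun i => (A i).min' (hne i) := by
      refine StrictMono.injective (f := fun i => (A i).min' (hne i)) fun i j hij => ?_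
      exact hlt i j hij _ (Finset.min'_mem _ _) _ (Finset.min'_mem _ _)
    have h := hS _ (Finset.mem_image_of_mem _ (Finset.mem_univ i))
    rw [Finset.card_image_of_injective _ hinj, Finset.card_univ, Fintype.card_fin] at h
    exact h.trans (by exact_mod_cast Finset.min'_le _ _ ha)
  · rintro ⟨n, A, hne, hG, hlt, hn, rfl⟩
    refine ⟨n, A, hne, hG, hlt, fun a ha => ?_, rfl⟩
    obtain ⟨i, -, rfl⟩ := Finset.mem_image.mp ha
    refine (Finset.card_image_le).trans ?_
    rw [Finset.card_univ, Fintype.card_fin]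
    exact hn i _ (Finset.min'_mem _ _)

theorem subset_convolution_schreierOne (G : Set (Finset ℕ+)) : G ⊆ convolution schreierOne G := by
  intro E hE
  rw [mem_convolution_schreierOne]
  rcases E.eq_empty_or_nonempty with rfl | hne
  · exact ⟨0, Fin.elim0, fun i => i.elim0, fun i => i.elim0, fun i => i.elim0, fun i => i.elim0,
      by simp⟩
  · refine ⟨1, fun _ => E, fun _ => hne, fun _ => hE, fun i j hij => ?_, fun _ a _ => a.pos,
      by simp⟩
    exact absurd hij (by simp [Subsingleton.elim i j])

theorem isSpreading_convolution_schreierOne {G : Set (Finset ℕ+)} (hG : IsSpreading G) :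
    IsSpreading (convolution schreierOne G) := by
  intro E hE h hh
  rw [mem_convolution_schreierOne] at hE ⊢
  obtain ⟨n, A, hne, hA, hlt, hn, rfl⟩ := hE
  refine ⟨n, fun i => (A i).image h, fun i => (hne i).image h, fun i => hG _ (hA i) h hh,
    fun i j hij a ha b hb => ?_, fun i a ha => ?_, Finset.biUnion_image⟩
  · obtain ⟨a, ha', rfl⟩ := Finset.mem_image.mp ha
    obtain ⟨b, hb', rfl⟩ := Finset.mem_image.mp hb
    exact hh (hlt i j hij a ha' b hb')
  · obtain ⟨a, ha', rfl⟩ := Finset.mem_image.mp ha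
    exact (hn i a ha').trans (by exact_mod_cast hh.le_apply_pnat a)

/-! ### Block absorption in the Schreier families -/

section Schreier

variable {s : Ordinal.{0} → ℕ+ → Ordinal.{0}}

theorem isSpreading_schreierZero : IsSpreading schreierZero := by
  rintro E (rfl | ⟨n, rfl⟩) h hh
  · exact Or.inl (by simp)
  · exact Or.inr ⟨h n, by simp⟩

theorem isSpreading_schreier (hs : IsLimitApproximation s) (ξ : Ordinal.{0})
    (hξ : ξ < Ordinal.omega 1) : IsSpreading (schreier s ξ) := by
  induction ξ using Ordinal.limitRecOn with
  | zero => rw [schreier_zero]; exact isSpreading_schreierZero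
  | add_one o ih =>
    rw [schreier_add_one]
    exact isSpreading_convolution_schreierOne (ih ((lt_add_one o).trans hξ))
  | limit o ho ih =>
    rw [schreier_limit s hs o ho hξ]
    rintro E ⟨n, hn, hE⟩ h hh
    have hlt := (hs o ho hξ).1 n
    refine ⟨n, fun i hi => ?_, ih _ hlt (hlt.trans hξ) E hE h hh⟩
    obtain ⟨i, hi', rfl⟩ := Finset.mem_image.mp hi
    exact (hn i hi').trans (hh.le_apply_pnat i)

theorem schreierZero_subset_schreier (hs : IsLimitApproximation s) (ξ : Ordinal.{0})
    (hξ : ξ < Ordinal.omega 1) : schreierZero ⊆ schreier s ξ := by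
  induction ξ using Ordinal.limitRecOn with
  | zero => rw [schreier_zero]
  | add_one o ih =>
    rw [schreier_add_one]
    exact (ih ((lt_add_one o).trans hξ)).trans (subset_convolution_schreierOne _)
  | limit o ho ih =>
    rw [schreier_limit s hs o ho hξ]
    intro E hE
    have hlt := (hs o ho hξ).1 1
    exact ⟨1, fun i _ => one_le, ih _ hlt (hlt.trans hξ) hE⟩

theorem IsLimitApproximation.exists_lt (hs : IsLimitApproximation s) {o a : Ordinal.{0}}
    (ho : Order.IsSuccLimit o) (ho' : o < Ordinal.omega 1) (h : a < o) : ∃ n, a < s o n := by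
  obtain ⟨_, ⟨n, rfl⟩, hn⟩ := (lt_isLUB_iff (hs o ho ho').2.2).mp h
  exact ⟨n, hn⟩

/-- For `α ≤ β`, the members of `𝓢_α` far enough to the right belong to `𝓢_β`. -/
theorem exists_forall_mem_schreier_of_le (hs : IsLimitApproximation s) (α β : Ordinal.{0})
    (hβ : β < Ordinal.omega 1) (h : α ≤ β) :
    ∃ k : ℕ+, ∀ E ∈ schreier s α, (∀ i ∈ E, k ≤ i) → E ∈ schreier s β := by
  induction β using Ordinal.limitRecOn with
  | zero =>
    obtain rfl := le_antisymm h (zero_le (a := α))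
    exact ⟨1, fun E hE _ => hE⟩
  | add_one o ih =>
    rcases h.eq_or_lt with rfl | h
    · exact ⟨1, fun E hE _ => hE⟩
    · obtain ⟨k, hk⟩ := ih ((lt_add_one o).trans hβ) (Order.lt_add_one_iff.mp h)
      rw [schreier_add_one]
      exact ⟨k, fun E hE hi => subset_convolution_schreierOne _ (hk E hE hi)⟩
  | limit o ho ih =>
    rcases h.eq_or_lt with rfl | h
    · exact ⟨1, fun E hE _ => hE⟩
    · obtain ⟨n, hn⟩ := hs.exists_lt ho hβ h
      have hlt := (hs o ho hβ).1 n
      obtain ⟨k, hk⟩ := ih _ hlt (hlt.trans hβ) hn.le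
      rw [schreier_limit s hs o ho hβ]
      exact ⟨max k n, fun E hE hi => ⟨n, fun i h => (le_max_right _ _).trans (hi i h),
        hk E hE fun i h => (le_max_left _ _).trans (hi i h)⟩⟩

/-- `F` absorbs blocks from `G`: the union, over an index set in `F`, of successive members of `G`
that are far enough to the right belongs to `H`. -/
def AbsorbsBlocks (F G H : Set (Finset ℕ+)) : Prop :=
  ∃ g : ℕ+ → ℕ+, ∀ J ∈ F, ∀ B : ℕ+ → Finset ℕ+, IsBlockSequence B → (∀ j ∈ J, B j ∈ G) →
    (∀ j ∈ J, ∀ a ∈ B j, g j ≤ a) → J.biUnion B ∈ H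

theorem exists_monotone_ge (u : ℕ+ → ℕ+) : ∃ g : ℕ+ → ℕ+, Monotone g ∧ ∀ n, u n ≤ g n :=
  ⟨fun j => (Finset.Iic j).sup' ⟨j, by simp⟩ u,
    fun _ _ h => Finset.sup'_mono u (Finset.Iic_subset_Iic.mpr h) _,
    fun n => Finset.le_sup' u (by simp)⟩

/-- Diagonal bound for limit stages: there the layer n is only known to satisfy n ≤ J, hence n ≤ j
for each j ∈ J. -/
theorem exists_ge_of_forall_le (u : ℕ+ → ℕ+ → ℕ+) :
    ∃ g : ℕ+ → ℕ+, ∀ n j, n ≤ j → u n j ≤ g j :=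
  ⟨fun j => (Finset.Iic j).sup' ⟨j, by simp⟩ fun n => u n j,
    fun n j h => Finset.le_sup' (fun n => u n j) (by simpa using h)⟩

theorem absorbsBlocks_convolution_schreierOne {F G H : Set (Finset ℕ+)} (h : AbsorbsBlocks F G H) :
    AbsorbsBlocks (convolution schreierOne F) G (convolution schreierOne H) := by
  obtain ⟨g, hg⟩ := h
  refine ⟨g, fun J hJ B hB hBG hgB => ?_⟩
  rw [mem_convolution_schreierOne] at hJ ⊢
  obtain ⟨n, A, hne, hA, hlt, hn, rfl⟩ := hJ
  refine ⟨n, fun i => (A i).biUnion B, fun i => ?_, fun i => hg _ (hA i) B hB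
      (fun j hj => hBG j (Finset.mem_biUnion.mpr ⟨i, Finset.mem_univ i, hj⟩))
      fun j hj => hgB j (Finset.mem_biUnion.mpr ⟨i, Finset.mem_univ i, hj⟩),
    fun i j hij a ha b hb => ?_, fun i a ha => ?_, Finset.biUnion_biUnion _ _ _⟩
  · obtain ⟨j, hj⟩ := hne i
    obtain ⟨a, ha⟩ := hB.nonempty j
    exact ⟨a, Finset.mem_biUnion.mpr ⟨j, hj, ha⟩⟩
  · obtain ⟨k, hk, ha⟩ := Finset.mem_biUnion.mp ha
    obtain ⟨l, hl, hb⟩ := Finset.mem_biUnion.mp hb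
    exact hB.lt k l (hlt i j hij k hk l hl) a ha b hb
  · obtain ⟨k, hk, ha⟩ := Finset.mem_biUnion.mp ha
    exact (hn i k hk).trans (by exact_mod_cast hB.le k a ha)

/-- Induction on η. At a limit o, a set J in layer n gives a union in the family of index ζ + s o n.
The sequence chosen for ζ + o need not be ζ + s o n, so the union is moved into the family of index
ζ + o by starting far enough out. -/
theorem absorbsBlocks_schreier (hs : IsLimitApproximation s) (ζ η : Ordinal.{0})
    (hζ : ζ < Ordinal.omega 1) (hη : η < Ordinal.omega 1) :
    AbsorbsBlocks (schreier s η) (schreier s ζ) (schreier s (ζ + η)) := by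
  induction η using Ordinal.limitRecOn with
  | zero =>
    rw [add_zero, schreier_zero]
    refine ⟨id, ?_⟩
    rintro J (rfl | ⟨n, rfl⟩) B hB hBG -
    · exact schreierZero_subset_schreier hs ζ hζ (Or.inl (by simp))
    · simpa using hBG n (by simp)
  | add_one o ih =>
    rw [← add_assoc, schreier_add_one, schreier_add_one]
    exact absorbsBlocks_convolution_schreierOne (ih ((lt_add_one o).trans hη))
  | limit o ho ih =>
    have hlt := (hs o ho hη).1
    have hsum : ζ + o < Ordinal.omega 1 := Ordinal.isPrincipal_add_omega 1 hζ hη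
    choose g hg using fun n => ih _ (hlt n) ((hlt n).trans hη)
    choose k hk using fun n =>
      exists_forall_mem_schreier_of_le hs (ζ + s o n) (ζ + o) hsum (by gcongr; exact (hlt n).le)
    obtain ⟨G, hG⟩ := exists_ge_of_forall_le fun n j => max (g n j) (k n)
    refine ⟨G, fun J hJ B hB hBG hgB => ?_⟩
    rw [schreier_limit s hs o ho hη] at hJ
    obtain ⟨n, hn, hJ⟩ := hJ
    refine hk n _ (hg n J hJ B hB hBG fun j hj a ha => ?_) fun a ha => ?_
    · exact (le_max_left _ _).trans ((hG n j (hn j hj)).trans (hgB j hj a ha))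
    · obtain ⟨j, hj, ha⟩ := Finset.mem_biUnion.mp ha
      exact (le_max_right _ _).trans ((hG n j (hn j hj)).trans (hgB j hj a ha))

/-- A family `F` which is the union of spreading layers `G n`, truncated at `n`, absorbs blocks
from each layer, and absorbs pairs. -/
structure IsLayered (F : Set (Finset ℕ+)) (G : ℕ+ → Set (Finset ℕ+)) : Prop where
  mem_iff : ∀ E, E ∈ F ↔ ∃ n, (∀ i ∈ E, n ≤ i) ∧ E ∈ G n
  spreading : ∀ n, IsSpreading (G n)
  absorbs : ∀ n, AbsorbsBlocks F (G n) F
  absorbs_pairs : AbsorbsBlocks F {E | E.card ≤ 2} F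
  singleton_mem : ∀ n, {n} ∈ F

theorem absorbsBlocks_schreierOne_card (n : ℕ) :
    AbsorbsBlocks schreierOne {E | E.card ≤ n} schreierOne := by
  -- For j ∈ J the union has at most |J| n ≤ j n elements; n + 1 replaces n to keep the threshold
  -- positive.
  refine ⟨fun j => j * n.succPNat, fun J hJ B hB hBG hgB a ha => ?_⟩
  obtain ⟨j, hj, ha⟩ := Finset.mem_biUnion.mp ha
  calc (J.biUnion B).card ≤ J.card * n := Finset.card_biUnion_le_card_mul _ _ _ hBG
    _ ≤ j * n.succPNat := by
      gcongr
      · exact hJ j hj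
      · exact Nat.le_succ n
    _ ≤ a := by exact_mod_cast hgB j hj a ha

theorem isLayered_schreierOne : IsLayered schreierOne fun n => {E | E.card ≤ n} where
  mem_iff E := by
    constructor
    · intro hE
      rcases E.eq_empty_or_nonempty with rfl | hne
      · exact ⟨1, by simp, by simp⟩
      · exact ⟨E.min' hne, fun i hi => Finset.min'_le _ _ hi, hE _ (Finset.min'_mem _ _)⟩
    · rintro ⟨n, hn, hE⟩ i hi
      exact le_trans hE (by exact_mod_cast hn i hi)
  spreading n E hE h _ := Finset.card_image_le.trans hE
  absorbs n := absorbsBlocks_schreierOne_card n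
  absorbs_pairs := absorbsBlocks_schreierOne_card 2
  singleton_mem n i _ := by rw [Finset.card_singleton]; exact i.pos

/-- Indecomposability of ω^ξ gives absorption from every index ζ < ω^ξ. Pairs are covered by ζ = 1,
which is below ω^ξ because ξ ≠ 0. -/
theorem isLayered_schreier_limit (hs : IsLimitApproximation s) (ξ : Ordinal.{0}) (h0 : ξ ≠ 0)
    (hξ : Ordinal.omega0 ^ ξ < Ordinal.omega 1) :
    IsLayered (schreier s (Ordinal.omega0 ^ ξ))
      fun n => schreier s (s (Ordinal.omega0 ^ ξ) n) := by
  have hlim : Order.IsSuccLimit (Ordinal.omega0 ^ ξ) :=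
    Ordinal.isSuccLimit_opow_left Ordinal.isSuccLimit_omega0 h0
  have hlt := (hs _ hlim hξ).1
  have habs : ∀ ζ < Ordinal.omega0 ^ ξ, AbsorbsBlocks (schreier s (Ordinal.omega0 ^ ξ))
      (schreier s ζ) (schreier s (Ordinal.omega0 ^ ξ)) := by
    intro ζ hζ
    have := absorbsBlocks_schreier hs ζ (Ordinal.omega0 ^ ξ) (hζ.trans hξ) hξ
    rwa [Ordinal.add_omega0_opow hζ] at this
  refine ⟨fun E => by rw [schreier_limit s hs _ hlim hξ]; rfl,
    fun n => isSpreading_schreier hs _ ((hlt n).trans hξ), fun n => habs _ (hlt n), ?_,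
    fun n => schreierZero_subset_schreier hs _ hξ (Or.inr ⟨n, rfl⟩)⟩
  obtain ⟨g, hg⟩ := habs 1 (Ordinal.one_lt_opow.mpr ⟨Ordinal.one_lt_omega0, h0⟩)
  rw [schreier_one] at hg
  refine ⟨fun j => max (g j) 2, fun J hJ B hB hBG hgB => hg J hJ B hB (fun j hj a ha => ?_)
    fun j hj a ha => (le_max_left _ _).trans (hgB j hj a ha)⟩
  have h2 : (2 : ℕ+) ≤ a := (le_max_right _ _).trans (hgB j hj a ha)
  exact le_trans (hBG j hj) (by exact_mod_cast h2)

theorem exists_isLayered_schreier (hs : IsLimitApproximation s) (ξ : Ordinal.{0})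
    (hξ : ξ < Ordinal.omega 1) : ∃ G, IsLayered (schreier s (Ordinal.omega0 ^ ξ)) G := by
  rcases eq_or_ne ξ 0 with rfl | h0
  · rw [Ordinal.opow_zero, schreier_one]
    exact ⟨_, isLayered_schreierOne⟩
  · exact ⟨_, isLayered_schreier_limit hs ξ h0
      (Ordinal.isPrincipal_opow_omega 1 Ordinal.omega0_lt_omega_one hξ)⟩

end Schreier

/-! ### Mazur's construction of basic sequences -/

section BasicSequences

variable {𝕜 : Type*} [RCLike 𝕜] {Z : Type*} [NormedAddCommGroup Z] [NormedSpace 𝕜 Z]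

open Filter Topology

/-- The partial sums of every finite linear combination are bounded by `K` times the whole sum. -/
def HasBoundedPartialSums (𝕜 : Type*) [RCLike 𝕜] {Z : Type*} [NormedAddCommGroup Z]
    [NormedSpace 𝕜 Z] (x : ℕ → Z) (K : ℝ) : Prop :=
  ∀ (a : ℕ → 𝕜) (m n : ℕ), m ≤ n →
    ‖∑ i ∈ Finset.range m, a i • x i‖ ≤ K * ‖∑ i ∈ Finset.range n, a i • x i‖

theorem HasBoundedPartialSums.norm_smul_le {x : ℕ → Z} {K : ℝ} (h : HasBoundedPartialSums 𝕜 x K)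
    (a : ℕ → 𝕜) {m n : ℕ} (hmn : m < n) :
    ‖a m • x m‖ ≤ 2 * K * ‖∑ i ∈ Finset.range n, a i • x i‖ := by
  have h1 : a m • x m =
      ∑ i ∈ Finset.range (m + 1), a i • x i - ∑ i ∈ Finset.range m, a i • x i := by
    rw [Finset.sum_range_succ]; abel
  rw [h1]
  linarith [norm_sub_le (∑ i ∈ Finset.range (m + 1), a i • x i) (∑ i ∈ Finset.range m, a i • x i),
    h a (m + 1) n hmn, h a m n hmn.le]

theorem Finsupp.exists_linearCombination_eq_sum_range (x : ℕ → Z) (f : ℕ →₀ 𝕜) (N : ℕ) :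
    ∃ n, N ≤ n ∧ Finsupp.linearCombination 𝕜 x f = ∑ i ∈ Finset.range n, f i • x i := by
  obtain ⟨n, hn⟩ := f.support.exists_nat_subset_range
  refine ⟨max n N, le_max_right _ _, ?_⟩
  rw [Finsupp.linearCombination_apply]
  refine Finsupp.sum_of_support_subset _ (hn.trans ?_) _ (by simp)
  exact Finset.range_mono (le_max_left _ _)

theorem HasBoundedPartialSums.linearIndependent {x : ℕ → Z} {K : ℝ}
    (h : HasBoundedPartialSums 𝕜 x K) (hx : ∀ n, x n ≠ 0) : LinearIndependent 𝕜 x := by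
  rw [linearIndependent_iff]
  intro f hf
  ext m
  obtain ⟨n, hn, hfn⟩ := Finsupp.exists_linearCombination_eq_sum_range x f (m + 1)
  have h1 := h.norm_smul_le f (m := m) (n := n) hn
  rw [← hfn, hf, norm_zero, mul_zero] at h1
  simpa [hx m] using h1

/-- The coordinate functional is bounded on the span, as a difference of two partial sums controls
each term; Hahn–Banach extends it. -/
theorem HasBoundedPartialSums.exists_biorthogonal {x : ℕ → Z} {K : ℝ}
    (h : HasBoundedPartialSums 𝕜 x K) (hx : ∀ n, x n ≠ 0) (m : ℕ) :
    ∃ g : StrongDual 𝕜 Z, ∀ n, g (x n) = (Pi.single n (1 : 𝕜) : ℕ → 𝕜) m := by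
  have hli := h.linearIndependent hx
  let φ : Submodule.span 𝕜 (Set.range x) →ₗ[𝕜] 𝕜 := (Finsupp.lapply m).comp hli.repr
  have hφ : ∀ v, ‖φ v‖ ≤ 2 * K / ‖x m‖ * ‖v‖ := by
    intro v
    obtain ⟨n, hn, hfn⟩ := Finsupp.exists_linearCombination_eq_sum_range x (hli.repr v) (m + 1)
    have h1 := h.norm_smul_le (hli.repr v) (m := m) (n := n) hn
    rw [← hfn, hli.linearCombination_repr, norm_smul] at h1
    rw [div_mul_eq_mul_div, le_div_iff₀ (norm_pos_iff.mpr (hx m))]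
    exact h1
  obtain ⟨g, hg, -⟩ := exists_extension_norm_eq _ (φ.mkContinuous _ hφ)
  refine ⟨g, fun n => ?_⟩
  have h1 := hg ⟨x n, Submodule.subset_span ⟨n, rfl⟩⟩
  rw [LinearMap.mkContinuous_apply] at h1
  rw [h1]
  change hli.repr _ m = _
  rw [hli.repr_eq_single n _ rfl, Finsupp.single_apply, Pi.single_apply]
  simp only [eq_comm]

/-- Mazur's criterion for basic sequences. -/
theorem HasBoundedPartialSums.isBasicSequence {x : ℕ+ → Z} {K : ℝ}
    (h : HasBoundedPartialSums 𝕜 (fun n => x n.succPNat) K) (hx : ∀ n, x n ≠ 0) :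
    IsBasicSequence 𝕜 x := by
  set y : ℕ → Z := fun n => x n.succPNat with hy
  have hrange : Set.range x = Set.range y := by
    ext v
    constructor
    · rintro ⟨n, rfl⟩
      exact ⟨n.natPred, by simp [hy]⟩
    · rintro ⟨n, rfl⟩
      exact ⟨_, rfl⟩
  choose g hg using h.exists_biorthogonal fun n => hx n.succPNat
  have hK : 0 ≤ K := by
    have h1 := h (fun _ => 1) 1 1 le_rfl
    by_contra hK
    have h2 : 0 < ‖y 0‖ := norm_pos_iff.mpr (hx _)
    simp only [Finset.range_one, Finset.sum_singleton, one_smul] at h1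
    nlinarith
  -- partial sum operators
  have hP : ∀ f : ℕ →₀ 𝕜, ∀ n, ∑ i ∈ Finset.range n, g i (Finsupp.linearCombination 𝕜 y f) • y i
      = ∑ i ∈ Finset.range n, f i • y i := by
    intro f n
    refine Finset.sum_congr rfl fun i _ => ?_
    congr 1
    rw [Finsupp.linearCombination_apply, Finsupp.sum, map_sum]
    simp only [map_smul, hg, Pi.single_apply]
    simpa [Finset.sum_ite_eq] using Eq.symm
  have hbound : ∀ v ∈ (Submodule.span 𝕜 (Set.range x)).topologicalClosure, ∀ n,
      ‖∑ i ∈ Finset.range n, g i v • y i‖ ≤ K * ‖v‖ := by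
    intro v hv n
    rw [← SetLike.mem_coe, Submodule.topologicalClosure_coe] at hv
    -- The bound is a closed condition on v, so it suffices to check it on the span.
    refine closure_minimal (t := {v | ‖∑ i ∈ Finset.range n, g i v • y i‖ ≤ K * ‖v‖}) ?_
      (isClosed_le (by fun_prop) (by fun_prop)) hv
    intro v hv
    rw [SetLike.mem_coe, hrange, Finsupp.mem_span_range_iff_exists_finsupp] at hv
    obtain ⟨f, rfl⟩ := hv
    change ‖∑ i ∈ Finset.range n, g i (Finsupp.linearCombination 𝕜 y f) • y i‖ ≤
      K * ‖Finsupp.linearCombination 𝕜 y f‖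
    obtain ⟨N, hN, hf⟩ := Finsupp.exists_linearCombination_eq_sum_range y f n
    rw [hP, hf]
    exact h f n N hN
  have htend : ∀ v ∈ (Submodule.span 𝕜 (Set.range x)).topologicalClosure,
      Tendsto (fun n => ∑ i ∈ Finset.range n, g i v • y i) atTop (𝓝 v) := by
    intro v hv
    rw [Metric.tendsto_atTop]
    intro ε hε
    have hv' : v ∈ closure (Submodule.span 𝕜 (Set.range x) : Set Z) := hv
    obtain ⟨u, hu, huv⟩ := Metric.mem_closure_iff.mp hv' (ε / (K + 2)) (by positivity)
    have hu' := hu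
    rw [SetLike.mem_coe, hrange, Finsupp.mem_span_range_iff_exists_finsupp] at hu
    obtain ⟨f, hf⟩ := hu
    change Finsupp.linearCombination 𝕜 y f = u at hf
    obtain ⟨N, hN⟩ := f.support.exists_nat_subset_range
    refine ⟨N, fun n hn => ?_⟩
    have h1 : ∑ i ∈ Finset.range n, g i u • y i = u := by
      rw [← hf, hP, Finsupp.linearCombination_apply]
      exact (Finsupp.sum_of_support_subset _ (hN.trans (Finset.range_mono hn))
        (fun i b => b • y i) fun i _ => zero_smul 𝕜 (y i)).symm
    have h2 := hbound (v - u) (sub_mem hv (Submodule.le_topologicalClosure _ hu')) n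
    simp only [map_sub, sub_smul, Finset.sum_sub_distrib, h1] at h2
    rw [dist_eq_norm] at huv ⊢
    have h3 : ∑ i ∈ Finset.range n, g i v • y i - v =
      (∑ i ∈ Finset.range n, g i v • y i - u) - (v - u) := by abel
    rw [h3]
    have h4 : (K + 2) * ‖v - u‖ < ε := by
      rwa [lt_div_iff₀ (by positivity), mul_comm] at huv
    linarith [norm_sub_le (∑ i ∈ Finset.range n, g i v • y i - u) (v - u), norm_nonneg (v - u)]
  have hmem : ∀ n, y n ∈ (Submodule.span 𝕜 (Set.range x)).topologicalClosure := fun n =>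
    Submodule.le_topologicalClosure _ (Submodule.subset_span ⟨_, rfl⟩)
  refine ⟨⟨fun n => ⟨y n, hmem n⟩, fun n => (g n).comp (Submodule.subtypeL _), fun i j => ?_,
    fun v => ?_⟩, fun n => rfl⟩
  · refine Eq.trans (b := g i (y j)) rfl ?_
    convert hg i j
  -- The expansion need only converge along initial segments, which is `htend`.
  · rw [HasSum, SummationFilter.conditional_filter_eq_map_range, tendsto_map'_iff,
      tendsto_subtype_rng]
    refine (htend v v.2).congr fun n => ?_
    simp

/-- Take Hahn–Banach functionals norming a countable set whose closure contains S. -/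
theorem exists_norming_sequence (S : Submodule 𝕜 Z)
    (hS : TopologicalSpace.IsSeparable (S : Set Z)) :
    ∃ f : ℕ → StrongDual 𝕜 Z, (∀ k, ‖f k‖ ≤ 1) ∧
      ∀ v ∈ S, ∀ ε > 0, ∃ k, ‖v‖ - ε < ‖f k v‖ := by
  obtain ⟨D, hD, hSD⟩ := hS
  have hDne : D.Nonempty := closure_nonempty_iff.mp ⟨0, hSD S.zero_mem⟩
  obtain ⟨d, rfl⟩ := hD.exists_eq_range hDne
  choose f hf1 hf using fun k => exists_dual_vector'' 𝕜 (d k)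
  refine ⟨f, hf1, fun v hv ε hε => ?_⟩
  obtain ⟨_, ⟨k, rfl⟩, hk⟩ := Metric.mem_closure_iff.mp (hSD hv) (ε / 2) (half_pos hε)
  rw [dist_eq_norm] at hk
  refine ⟨k, ?_⟩
  have h1 : ‖f k (v - d k)‖ ≤ ‖v - d k‖ := (f k).le_of_opNorm_le_of_le (hf1 k) le_rfl |>.trans
    (by rw [one_mul])
  have h2 : ‖f k (d k)‖ = ‖d k‖ := by rw [hf]; simp
  have h3 : ‖d k‖ ≤ ‖f k v‖ + ‖f k (v - d k)‖ := by
    rw [← h2, show f k (d k) = f k v - f k (v - d k) by simp]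
    exact norm_sub_le _ _
  have h4 : ‖v‖ ≤ ‖d k‖ + ‖v - d k‖ := by
    simpa using norm_add_le (d k) (v - d k)
  linarith

theorem exists_subseq_forall_tendsto (f : ℕ → StrongDual 𝕜 Z) {z : ℕ → Z} {C : ℝ}
    (hf : ∀ k, ‖f k‖ ≤ 1) (hz : ∀ n, ‖z n‖ ≤ C) :
    ∃ φ : ℕ → ℕ, StrictMono φ ∧ ∀ k, ∃ l, Tendsto (fun n => f k (z (φ n))) atTop (𝓝 l) := by
  have hK : IsCompact (Set.univ.pi fun _ : ℕ => Metric.closedBall (0 : 𝕜) C) :=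
    isCompact_univ_pi fun _ => isCompact_closedBall _ _
  obtain ⟨l, -, φ, hφ, hl⟩ := hK.tendsto_subseq (x := fun n k => f k (z n)) fun n k _ => by
    rw [mem_closedBall_zero_iff]
    exact ((f k).le_of_opNorm_le_of_le (hf k) (hz n)).trans (by rw [one_mul])
  exact ⟨φ, hφ, fun k => ⟨l k, (tendsto_pi_nhds.mp hl) k⟩⟩

/-- Mazur's lemma: against a finite-dimensional subspace `V`, vectors which are small on enough
norming functionals are almost orthogonal. -/
theorem eventually_le_norm_add_smul {S : Submodule 𝕜 Z} {f : ℕ → StrongDual 𝕜 Z}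
    (hf1 : ∀ k, ‖f k‖ ≤ 1) (hf : ∀ v ∈ S, ∀ ε > 0, ∃ k, ‖v‖ - ε < ‖f k v‖) {w : ℕ → Z} {δ : ℝ}
    (hδ : 0 < δ) (hw : ∀ n, δ ≤ ‖w n‖) (hfw : ∀ k, Tendsto (fun n => f k (w n)) atTop (𝓝 0))
    {V : Submodule 𝕜 Z} [FiniteDimensional 𝕜 V] (hVS : V ≤ S) {η : ℝ} (hη : 0 < η) :
    ∀ᶠ n in atTop, ∀ v ∈ V, ∀ t : 𝕜, (1 - η) * ‖v‖ ≤ ‖v + t • w n‖ := by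
  have : ProperSpace V := FiniteDimensional.proper 𝕜 V
  obtain ⟨T, hT⟩ := (isCompact_sphere (0 : V) 1).elim_finite_subcover
    (fun k => {v : V | 1 - η / 2 < ‖f k v‖})
    (fun k => isOpen_lt continuous_const (by fun_prop)) fun v hv => by
      rw [mem_sphere_zero_iff_norm] at hv
      obtain ⟨k, hk⟩ := hf v (hVS v.2) (η / 2) (half_pos hη)
      refine Set.mem_iUnion.mpr ⟨k, ?_⟩
      rwa [show ‖(v : Z)‖ = 1 from hv] at hk
  -- When ‖t • w n‖ < 2, one has ‖t‖ ≤ 2/δ, so this tolerance makes the error at most η/2. When ‖t •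
  -- w n‖ ≥ 2, the triangle inequality suffices.
  have hev : ∀ᶠ n in atTop, ∀ k ∈ T, ‖f k (w n)‖ < η * δ / 4 := by
    rw [Filter.eventually_all_finset]
    intro k _
    have := (hfw k).norm
    rw [norm_zero] at this
    exact this.eventually_lt_const (by positivity)
  filter_upwards [hev] with n hn v hv t
  have key : ∀ u ∈ V, ‖u‖ = 1 → ∀ t : 𝕜, 1 - η ≤ ‖u + t • w n‖ := by
    intro u hu hu1 t
    by_cases ht : 2 ≤ ‖t • w n‖
    · have : ‖t • w n‖ ≤ ‖u + t • w n‖ + ‖u‖ := by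
        simpa using norm_sub_le (u + t • w n) u
      linarith
    · have hu' : (⟨u, hu⟩ : V) ∈ Metric.sphere (0 : V) 1 := by
        rw [mem_sphere_zero_iff_norm]; exact hu1
      obtain ⟨k, hk⟩ := Set.mem_iUnion.mp (hT hu')
      obtain ⟨hkT, hk⟩ := Set.mem_iUnion.mp hk
      have hk : 1 - η / 2 < ‖f k u‖ := hk
      rw [norm_smul] at ht
      have h1 : ‖t‖ * δ ≤ 2 := by
        nlinarith [hw n, norm_nonneg t]
      have h2 : ‖t‖ * ‖f k (w n)‖ ≤ η / 2 := by
        have := mul_le_mul_of_nonneg_left (hn k hkT).le (norm_nonneg t)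
        nlinarith
      have h3 : ‖f k u‖ ≤ ‖f k (u + t • w n)‖ + ‖t‖ * ‖f k (w n)‖ := by
        rw [← norm_smul]
        simpa using norm_sub_le (f k (u + t • w n)) (t • f k (w n))
      have h4 := (f k).le_of_opNorm_le_of_le (hf1 k) (le_refl ‖u + t • w n‖)
      linarith
  rcases eq_or_ne v 0 with rfl | hv0
  · simp
  · have hv1 : 0 < ‖v‖ := norm_pos_iff.mpr hv0
    have hv2 : (‖v‖ : 𝕜) ≠ 0 := by exact_mod_cast hv1.ne'
    have h1 := key ((‖v‖ : 𝕜)⁻¹ • v) (V.smul_mem _ hv)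
      (by rw [norm_smul, norm_inv, RCLike.norm_ofReal, abs_norm, inv_mul_cancel₀ hv1.ne'])
      ((‖v‖ : 𝕜)⁻¹ * t)
    rw [mul_smul, ← smul_add, norm_smul, norm_inv, RCLike.norm_ofReal, abs_norm,
      ← div_eq_inv_mul, le_div_iff₀ hv1] at h1
    exact h1

theorem exists_subseq_hasBoundedPartialSums {S : Submodule 𝕜 Z} {f : ℕ → StrongDual 𝕜 Z}
    (hf1 : ∀ k, ‖f k‖ ≤ 1) (hf : ∀ v ∈ S, ∀ ε > 0, ∃ k, ‖v‖ - ε < ‖f k v‖) {w : ℕ → Z} {δ : ℝ}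
    (hδ : 0 < δ) (hw : ∀ n, δ ≤ ‖w n‖) (hwS : ∀ n, w n ∈ S)
    (hfw : ∀ k, Tendsto (fun n => f k (w n)) atTop (𝓝 0)) :
    ∃ ψ : ℕ → ℕ, StrictMono ψ ∧ HasBoundedPartialSums 𝕜 (w ∘ ψ) 2 := by
  -- The factors decrease strictly from 2 and stay above 1. Each new vector is chosen with loss r (k
  -- + 1) / r k, so the norm of the k-th partial sum divided by r k is non-decreasing and the total
  -- loss is at most 2.
  let r : ℕ → ℝ := fun k => 1 + 1 / ((k : ℝ) + 1)
  have hr1 : ∀ k, 1 < r k := fun k => by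
    have : 0 < 1 / ((k : ℝ) + 1) := by positivity
    simp only [r]; linarith
  have hr2 : ∀ k, r k ≤ 2 := fun k => by
    have : 1 / ((k : ℝ) + 1) ≤ 1 := by
      rw [div_le_one (by positivity)]; linarith [(Nat.cast_nonneg k : (0 : ℝ) ≤ k)]
    simp only [r]; linarith
  have hr3 : ∀ k, r (k + 1) < r k := fun k => by
    have : 1 / (((k + 1 : ℕ) : ℝ) + 1) < 1 / ((k : ℝ) + 1) := by
      apply one_div_lt_one_div_of_lt (by positivity); push_cast; linarith
    simp only [r]; linarith
  have hstep : ∀ k N : ℕ, ∃ N', N < N' ∧ ∀ v ∈ Submodule.span 𝕜 (w '' Set.Iic N), ∀ t : 𝕜,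
      ‖v‖ / r k ≤ ‖v + t • w N'‖ / r (k + 1) := by
    intro k N
    have : FiniteDimensional 𝕜 (Submodule.span 𝕜 (w '' Set.Iic N)) :=
      FiniteDimensional.span_of_finite 𝕜 ((Set.finite_Iic N).image w)
    have hVS : Submodule.span 𝕜 (w '' Set.Iic N) ≤ S := by
      rw [Submodule.span_le]
      rintro _ ⟨n, -, rfl⟩
      exact hwS n
    have hk0 : 0 < r k := zero_lt_one.trans (hr1 k)
    have hk1 : 0 < r (k + 1) := zero_lt_one.trans (hr1 (k + 1))
    have hη : 0 < 1 - r (k + 1) / r k := by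
      rw [sub_pos, div_lt_one hk0]; exact hr3 k
    obtain ⟨N', h1, h2⟩ := ((eventually_le_norm_add_smul hf1 hf hδ hw hfw hVS hη).and
      (eventually_gt_atTop N)).exists
    refine ⟨N', h2, fun v hv t => ?_⟩
    have h3 := h1 v hv t
    rw [sub_sub_cancel] at h3
    rw [le_div_iff₀ hk1]
    calc ‖v‖ / r k * r (k + 1) = r (k + 1) / r k * ‖v‖ := by ring
      _ ≤ _ := h3
  choose next hnext hle using hstep
  let ψ : ℕ → ℕ := fun n => Nat.rec (next 0 0) (fun k N => next (k + 1) N) n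
  have hψ : ∀ k, ψ (k + 1) = next (k + 1) (ψ k) := fun k => rfl
  have hmono : StrictMono ψ := strictMono_nat_of_lt_succ fun k => hnext (k + 1) (ψ k)
  refine ⟨ψ, hmono, fun a m n hmn => ?_⟩
  have hquot : Monotone fun n => ‖∑ i ∈ Finset.range n, a i • (w ∘ ψ) i‖ / r n := by
    refine monotone_nat_of_le_succ fun k => ?_
    rw [Finset.sum_range_succ]
    cases k with
    | zero =>
      simp only [Finset.range_zero, Finset.sum_empty, norm_zero, zero_div]
      exact div_nonneg (norm_nonneg _) (zero_le_one.trans (hr1 _).le)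
    | succ k =>
      refine hle (k + 1) (ψ k) _ (Submodule.sum_mem _ fun i hi => ?_) (a (k + 1))
      refine Submodule.smul_mem _ _ (Submodule.subset_span ⟨ψ i, ?_, rfl⟩)
      exact hmono.monotone (Finset.mem_range_succ_iff.mp hi)
  have h1 := hquot hmn
  simp only at h1
  set A := ‖∑ i ∈ Finset.range m, a i • (w ∘ ψ) i‖
  set B := ‖∑ i ∈ Finset.range n, a i • (w ∘ ψ) i‖
  have hB : 0 ≤ B := norm_nonneg _
  rw [div_le_iff₀ (zero_lt_one.trans (hr1 m))] at h1
  refine h1.trans ?_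
  have h2 : B / r n ≤ B := div_le_self hB (hr1 n).le
  nlinarith [hr2 m, hr1 m]

end BasicSequences

/-! ### Lower ℓ₁ estimates and spreading models -/

section SpreadingModels

variable {𝕜 : Type*} [RCLike 𝕜] {Z : Type*} [NormedAddCommGroup Z] [NormedSpace 𝕜 Z]

open Filter Topology

/-- The sequence `z` satisfies a lower `ℓ₁` estimate with constant `c` on the sets in `F`. -/
def HasLowerL1Estimate (𝕜 : Type*) [RCLike 𝕜] {Z : Type*} [NormedAddCommGroup Z] [NormedSpace 𝕜 Z]
    (F : Set (Finset ℕ+)) (c : ℝ) (z : ℕ+ → Z) : Prop :=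
  ∀ E ∈ F, ∀ a : ℕ+ → 𝕜, c * ∑ i ∈ E, ‖a i‖ ≤ ‖∑ i ∈ E, a i • z i‖

theorem HasLowerL1Estimate.le_norm_sum_blocks {F : Set (Finset ℕ+)} {c : ℝ} {z : ℕ+ → Z}
    (h : HasLowerL1Estimate 𝕜 F c z) {B : ℕ+ → Finset ℕ+} (hB : IsBlockSequence B)
    {J : Finset ℕ+} (hJ : J.biUnion B ∈ F) (a : ℕ+ → ℕ+ → 𝕜) (b : ℕ+ → 𝕜) :
    c * ∑ j ∈ J, ‖b j‖ * ∑ i ∈ B j, ‖a j i‖ ≤ ‖∑ j ∈ J, b j • ∑ i ∈ B j, a j i • z i‖ := by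
  have hdisj := hB.pairwiseDisjoint (J : Set ℕ+)
  -- Disjointness of the blocks leaves at most one non-zero summand.
  let A : ℕ+ → 𝕜 := fun i => ∑ j ∈ J, if i ∈ B j then b j * a j i else 0
  have hA : ∀ j ∈ J, ∀ i ∈ B j, A i = b j * a j i := by
    intro j hj i hi
    simp only [A]
    rw [Finset.sum_eq_single_of_mem j hj, if_pos hi]
    intro k hk hkj
    exact if_neg fun hik => Finset.disjoint_left.mp (hdisj hk hj hkj) hik hi
  have h1 := h _ hJ A
  rw [Finset.sum_biUnion hdisj, Finset.sum_biUnion hdisj] at h1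
  have h2 : ∑ j ∈ J, ∑ i ∈ B j, ‖A i‖ = ∑ j ∈ J, ‖b j‖ * ∑ i ∈ B j, ‖a j i‖ :=
    Finset.sum_congr rfl fun j hj => by
      rw [Finset.mul_sum]
      exact Finset.sum_congr rfl fun i hi => by rw [hA j hj i hi, norm_mul]
  have h3 : ∑ j ∈ J, ∑ i ∈ B j, A i • z i = ∑ j ∈ J, b j • ∑ i ∈ B j, a j i • z i :=
    Finset.sum_congr rfl fun j hj => by
      rw [Finset.smul_sum]
      exact Finset.sum_congr rfl fun i hi => by rw [hA j hj i hi, mul_smul]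
  rwa [h2, h3] at h1

theorem HasLowerL1Estimate.le_norm {F : Set (Finset ℕ+)} {c : ℝ} {z : ℕ+ → Z}
    (h : HasLowerL1Estimate 𝕜 F c z) {n : ℕ+} (hn : {n} ∈ F) : c ≤ ‖z n‖ := by
  simpa using h _ hn fun _ => 1

/-- Each difference is a two-point block with coefficients 1 and -1, of ℓ₁ norm 2; this is where 2c
comes from. -/
theorem HasLowerL1Estimate.sub_pairs {F : Set (Finset ℕ+)} {c : ℝ} {z : ℕ+ → Z}
    (h : HasLowerL1Estimate 𝕜 F c z) {g : ℕ+ → ℕ+} (hg : ∀ J ∈ F, ∀ B : ℕ+ → Finset ℕ+,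
      IsBlockSequence B → (∀ j ∈ J, B j ∈ {E | E.card ≤ 2}) →
      (∀ j ∈ J, ∀ a ∈ B j, g j ≤ a) → J.biUnion B ∈ F)
    {m : ℕ → ℕ+} (hm : StrictMono m) {ψ : ℕ → ℕ} (hψ : StrictMono ψ)
    (hgm : ∀ j : ℕ+, g j ≤ m (2 * ψ j.natPred)) :
    HasLowerL1Estimate 𝕜 F (2 * c)
      fun j => z (m (2 * ψ j.natPred)) - z (m (2 * ψ j.natPred + 1)) := by
  intro J hJ b
  let p : ℕ+ → ℕ+ := fun j => m (2 * ψ j.natPred)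
  let r : ℕ+ → ℕ+ := fun j => m (2 * ψ j.natPred + 1)
  have hpr : ∀ j, p j < r j := fun j => hm (Nat.lt_succ_self _)
  have hrp : ∀ i j, i < j → r i < p j := fun i j hij => hm (by
    have := hψ (PNat.natPred_lt_natPred.mpr hij)
    omega)
  have hB : IsBlockSequence fun j => {p j, r j} := by
    refine ⟨fun j => by simp, fun i j hij a ha b hb => ?_⟩
    have h1 := hpr i
    have h2 := hpr j
    have h3 := hrp i j hij
    simp only [Finset.mem_insert, Finset.mem_singleton] at ha hb
    rcases ha with rfl | rfl <;> rcases hb with rfl | rfl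
    · exact h1.trans h3
    · exact (h1.trans h3).trans h2
    · exact h3
    · exact h3.trans h2
  have hmem := hg J hJ _ hB (fun j _ => Finset.card_le_two) fun j _ a ha => by
    simp only [Finset.mem_insert, Finset.mem_singleton] at ha
    rcases ha with rfl | rfl
    · exact hgm j
    · exact (hgm j).trans (hpr j).le
  have h1 := h.le_norm_sum_blocks hB hmem (fun j i => if i = p j then 1 else -1) b
  have h2 : ∀ j, r j ≠ p j := fun j => (hpr j).ne'
  simp only [Finset.sum_pair (hpr _).ne, if_neg (h2 _), if_true, norm_one, norm_neg, one_smul,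
    neg_smul, ← sub_eq_add_neg] at h1
  refine le_trans (le_of_eq ?_) h1
  rw [← Finset.sum_mul]
  ring

/-- A bounded sequence with a lower `ℓ₁` estimate on `F` yields an `ℓ₁` spreading model: suitable
differences of its terms form a basic sequence. -/
theorem HasLowerL1Estimate.containsL1SpreadingModel {F : Set (Finset ℕ+)} {c C : ℝ} {z : ℕ+ → Z}
    (h : HasLowerL1Estimate 𝕜 F c z) (hc : 0 < c) (hC : ∀ n, ‖z n‖ ≤ C)
    (hF : AbsorbsBlocks F {E | E.card ≤ 2} F) (hF1 : ∀ n, {n} ∈ F) :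
    ContainsL1SpreadingModel 𝕜 Z F := by
  obtain ⟨g, hg⟩ := hF
  obtain ⟨u, hu, hgu⟩ := exists_monotone_ge g
  obtain ⟨f, hf1, hf⟩ := exists_norming_sequence (Submodule.span 𝕜 (Set.range z))
    ((Set.countable_range z).isSeparable.span)
  obtain ⟨φ, hφ, hl⟩ := exists_subseq_forall_tendsto f hf1 (z := fun n => z n.succPNat)
    fun n => hC _
  choose l hl using hl
  -- Growing at least as fast as `u` ensures that the pairs stay beyond the thresholds `g` for every
  -- later choice of ψ.
  let θ : ℕ → ℕ := fun n => u n.succPNat + n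
  have hθ : StrictMono θ := by
    have : Monotone fun n : ℕ => (u n.succPNat : ℕ) := fun a b hab =>
      hu (Nat.succPNat_mono hab)
    exact this.add_strictMono strictMono_id
  let m : ℕ → ℕ+ := fun n => (φ (θ n)).succPNat
  have hm : StrictMono m := Nat.succPNat_strictMono.comp (hφ.comp hθ)
  have hgm : ∀ ψ : ℕ → ℕ, StrictMono ψ → ∀ j : ℕ+, g j ≤ m (2 * ψ j.natPred) := by
    intro ψ hψ j
    have h1 : j ≤ (2 * ψ j.natPred).succPNat := by
      rw [← PNat.coe_le_coe, Nat.succPNat_coe]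
      have := hψ.le_apply (x := j.natPred)
      have := PNat.natPred_add_one j
      omega
    refine (hgu j).trans ((hu h1).trans ?_)
    rw [← PNat.coe_le_coe, Nat.succPNat_coe]
    have := hφ.le_apply (x := θ (2 * ψ j.natPred))
    simp only [θ] at this ⊢
    omega
  let w : ℕ → Z := fun n => z (m (2 * n)) - z (m (2 * n + 1))
  have hlow : ∀ ψ : ℕ → ℕ, StrictMono ψ →
      HasLowerL1Estimate 𝕜 F (2 * c) fun j => w (ψ j.natPred) :=
    fun ψ hψ => h.sub_pairs hg hm hψ (hgm ψ hψ)
  have hw : ∀ n, 2 * c ≤ ‖w n‖ := fun n => by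
    have := (hlow id strictMono_id).le_norm (hF1 n.succPNat)
    simpa using this
  have hwS : ∀ n, w n ∈ Submodule.span 𝕜 (Set.range z) := fun n =>
    sub_mem (Submodule.subset_span ⟨_, rfl⟩) (Submodule.subset_span ⟨_, rfl⟩)
  -- Both halves of the difference run along subsequences with the same limit.
  have hfw : ∀ k, Tendsto (fun n => f k (w n)) atTop (𝓝 0) := by
    intro k
    have h1 : StrictMono fun n : ℕ => θ (2 * n) := hθ.comp fun a b hab => by lia
    have h2 : StrictMono fun n : ℕ => θ (2 * n + 1) := hθ.comp fun a b hab => by lia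
    have := ((hl k).comp h1.tendsto_atTop).sub ((hl k).comp h2.tendsto_atTop)
    rw [sub_self] at this
    refine this.congr fun n => ?_
    simp only [w, m, map_sub, Function.comp]
  have h2c : 0 < 2 * c := by positivity
  obtain ⟨ψ, hψ, hbasic⟩ := exists_subseq_hasBoundedPartialSums hf1 hf h2c hw hwS hfw
  have hC0 : 0 ≤ C := (norm_nonneg _).trans (hC 1)
  refine ⟨max 1 ((2 * c)⁻¹ * (2 * C + 1)), le_max_left _ _, fun j => w (ψ j.natPred),
    HasBoundedPartialSums.isBasicSequence (K := 2) ?_ fun n => ?_,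
    (2 * c)⁻¹, 2 * C + 1, by positivity, by positivity, le_max_right _ _, fun E hE a => ⟨?_, ?_⟩⟩
  · simpa [Function.comp_def] using hbasic
  · exact norm_pos_iff.mp (h2c.trans_le (hw _))
  · rw [inv_inv]
    exact hlow ψ hψ E hE a
  · rw [Finset.mul_sum]
    refine (norm_sum_le _ _).trans (Finset.sum_le_sum fun i _ => ?_)
    rw [norm_smul, mul_comm]
    gcongr
    have := norm_sub_le (z (m (2 * ψ i.natPred))) (z (m (2 * ψ i.natPred + 1)))
    linarith [hC (m (2 * ψ i.natPred)), hC (m (2 * ψ i.natPred + 1))]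

theorem ContainsL1SpreadingModel.exists_hasLowerL1Estimate {F : Set (Finset ℕ+)}
    (h : ContainsL1SpreadingModel 𝕜 Z F) (hF1 : ∀ n, {n} ∈ F) :
    ∃ (z : ℕ+ → Z) (c C : ℝ), 0 < c ∧ (∀ n, ‖z n‖ ≤ C) ∧ HasLowerL1Estimate 𝕜 F c z := by
  obtain ⟨K, -, x, -, c, C, hc, hC, -, hE⟩ := h
  refine ⟨x, c⁻¹, C, inv_pos.mpr hc, fun n => ?_, fun E h a => (hE E h a).1⟩
  simpa using (hE _ (hF1 n) fun _ => 1).2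

theorem exists_isBlockSequence {P : Finset ℕ+ → Prop}
    (h : ∀ m : ℕ+, ∃ E : Finset ℕ+, E.Nonempty ∧ P E ∧ ∀ i ∈ E, m ≤ i) (g : ℕ+ → ℕ+) :
    ∃ B, IsBlockSequence B ∧ (∀ j, P (B j)) ∧ ∀ j, ∀ a ∈ B j, g j ≤ a := by
  choose e hne hP hle using h
  -- Starting threshold of the block numbered n + 1: at least g (n + 1) and past the preceding
  -- block.
  let k : ℕ → ℕ+ := fun n =>
    Nat.rec (g 1) (fun n k => max (g (n + 1).succPNat) ((e k).max' (hne k) + 1)) n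
  have hk : ∀ n, k (n + 1) = max (g (n + 1).succPNat) ((e (k n)).max' (hne (k n)) + 1) :=
    fun n => rfl
  have hlt : ∀ n, ∀ a ∈ e (k n), a < k (n + 1) := fun n a ha => by
    rw [hk]
    exact lt_max_of_lt_right ((Finset.le_max' _ a ha).trans_lt (PNat.lt_add_right _ _))
  have hmono : Monotone k := monotone_nat_of_le_succ fun n => by
    obtain ⟨a, ha⟩ := hne (k n)
    exact (hle _ a ha).trans (hlt n a ha).le
  have hgk : ∀ n, g n.succPNat ≤ k n := fun n => by
    cases n with
    | zero => exact le_rfl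
    | succ n => rw [hk]; exact le_max_left _ _
  refine ⟨fun j => e (k j.natPred), ⟨fun j => hne _, fun i j hij a ha b hb => ?_⟩,
    fun j => hP _, fun j a ha => ?_⟩
  · exact (hlt _ a ha).trans_le
      ((hmono (Nat.succ_le_of_lt (PNat.natPred_lt_natPred.mpr hij))).trans (hle _ b hb))
  · have := hgk j.natPred
    rw [PNat.succPNat_natPred] at this
    exact this.trans (hle _ a ha)

theorem Submodule.exists_mem_norm_sub_lt {Y : Submodule 𝕜 Z} {v : Z} {ε : ℝ}
    (h : ‖Y.mkQ v‖ < ε) : ∃ y ∈ Y, ‖v - y‖ < ε := by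
  obtain ⟨u, hu, huv⟩ := Submodule.Quotient.norm_mk_lt (Y.mkQ v) (sub_pos.mpr h)
  refine ⟨v - u, ?_, ?_⟩
  · exact (Submodule.Quotient.eq Y).mp hu.symm
  · rw [sub_sub_cancel]
    linarith

/-- Blocks of `z` which are close to the subspace `Y` are perturbed to a sequence in `Y`. -/
theorem HasLowerL1Estimate.exists_of_blocks_near {F : Set (Finset ℕ+)} {c C : ℝ} {z : ℕ+ → Z}
    (h : HasLowerL1Estimate 𝕜 F c z) (hC : ∀ n, ‖z n‖ ≤ C) {Y : Submodule 𝕜 Z}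
    {B : ℕ+ → Finset ℕ+} (hB : IsBlockSequence B) (hBF : ∀ J ∈ F, J.biUnion B ∈ F)
    {a : ℕ+ → ℕ+ → 𝕜} (ha : ∀ j, ∑ i ∈ B j, ‖a j i‖ = 1)
    (hY : ∀ j, ‖Y.mkQ (∑ i ∈ B j, a j i • z i)‖ < c / 2) :
    ∃ y : ℕ+ → Y, (∀ j, ‖y j‖ ≤ C + c / 2) ∧ HasLowerL1Estimate 𝕜 F (c / 2) y := by
  choose y hyY hy using fun j => Submodule.exists_mem_norm_sub_lt (hY j)
  refine ⟨fun j => ⟨y j, hyY j⟩, fun j => ?_, fun J hJ b => ?_⟩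
  · have h1 : ‖∑ i ∈ B j, a j i • z i‖ ≤ C := by
      calc ‖∑ i ∈ B j, a j i • z i‖ ≤ ∑ i ∈ B j, ‖a j i‖ * C :=
            (norm_sum_le _ _).trans (Finset.sum_le_sum fun i _ => by
              rw [norm_smul]; gcongr; exact hC i)
        _ = C := by rw [← Finset.sum_mul, ha, one_mul]
    have h2 := norm_sub_le (∑ i ∈ B j, a j i • z i) (∑ i ∈ B j, a j i • z i - y j)
    rw [sub_sub_cancel] at h2
    exact h2.trans (add_le_add h1 (hy j).le)
  · have h1 := h.le_norm_sum_blocks hB (hBF J hJ) a b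
    simp only [ha, mul_one] at h1
    have h2 : ‖∑ j ∈ J, b j • ∑ i ∈ B j, a j i • z i - ∑ j ∈ J, b j • y j‖ ≤
        c / 2 * ∑ j ∈ J, ‖b j‖ := by
      rw [← Finset.sum_sub_distrib, Finset.mul_sum]
      refine (norm_sum_le _ _).trans (Finset.sum_le_sum fun j _ => ?_)
      rw [← smul_sub, norm_smul, mul_comm]
      gcongr
      exact (hy j).le
    have h3 := norm_le_norm_add_norm_sub' (∑ j ∈ J, b j • ∑ i ∈ B j, a j i • z i)
      (∑ j ∈ J, b j • y j)
    have h4 : ‖∑ j ∈ J, b j • (⟨y j, hyY j⟩ : Y)‖ = ‖∑ j ∈ J, b j • y j‖ :=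
      congrArg norm (show ((∑ j ∈ J, b j • (⟨y j, hyY j⟩ : Y) : Y) : Z) = _ by simp)
    rw [h4]
    linarith

/-- Diagonal choice: θ i ≥ m n whenever n ≤ i. If n ≤ E ∈ G n, spreading puts θ(E) in G n, beyond m
n, where the hypothesis applies. -/
theorem HasLowerL1Estimate.exists_subseq_of_layers {F : Set (Finset ℕ+)}
    {G : ℕ+ → Set (Finset ℕ+)} (hF : IsLayered F G) {c : ℝ} {x : ℕ+ → Z}
    (h : ∀ n, ∃ m : ℕ+, ∀ E ∈ G n, (∀ i ∈ E, m ≤ i) → ∀ a : ℕ+ → 𝕜, ∑ i ∈ E, ‖a i‖ = 1 →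
      c ≤ ‖∑ i ∈ E, a i • x i‖) :
    ∃ θ : ℕ+ → ℕ+, HasLowerL1Estimate 𝕜 F c (x ∘ θ) := by
  choose m hm using h
  obtain ⟨u, hu, hmu⟩ := exists_monotone_ge m
  have hθ : StrictMono fun n => u n + n := hu.add_strictMono strictMono_id
  set θ := fun n => u n + n
  refine ⟨θ, fun E hE a => ?_⟩
  have hmθ : ∀ n i, n ≤ i → m n ≤ θ i := fun n i hi =>
    (hmu n).trans ((hu hi).trans (PNat.lt_add_right _ _).le)
  obtain ⟨n, hn, hEn⟩ := (hF.mem_iff E).mp hE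
  set T := ∑ i ∈ E, ‖a i‖ with hT
  have hT0 : 0 ≤ T := Finset.sum_nonneg fun i _ => norm_nonneg _
  rcases hT0.eq_or_lt with hT1 | hT1
  · rw [← hT1, mul_zero]; exact norm_nonneg _
  -- The coefficients are normalised by T and transported to θ(E).
  · have h1 := hm n _ (hF.spreading n E hEn θ hθ) (fun i hi => by
      obtain ⟨j, hj, rfl⟩ := Finset.mem_image.mp hi
      exact hmθ n j (hn j hj)) (fun i => (T : 𝕜)⁻¹ * Function.extend θ a 0 i)
    simp only [Finset.sum_image hθ.injective.injOn, hθ.injective.extend_apply, norm_mul, norm_inv,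
      RCLike.norm_ofReal, abs_of_pos hT1, ← Finset.mul_sum, mul_smul, ← Finset.smul_sum,
      norm_smul] at h1
    have h2 := h1 (inv_mul_cancel₀ hT1.ne')
    rwa [← div_eq_inv_mul, le_div_iff₀ hT1] at h2

end SpreadingModels

/-! ### The three-space property -/

section ThreeSpace

variable {𝕜 : Type*} [RCLike 𝕜] {X : Type*} [NormedAddCommGroup X] [NormedSpace 𝕜 X]
  {F : Set (Finset ℕ+)} {G : ℕ+ → Set (Finset ℕ+)}

theorem ContainsL1SpreadingModel.of_submodule (hF : IsLayered F G) {Y : Submodule 𝕜 X}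
    (h : ContainsL1SpreadingModel 𝕜 Y F) : ContainsL1SpreadingModel 𝕜 X F := by
  obtain ⟨z, c, C, hc, hC, hz⟩ := h.exists_hasLowerL1Estimate hF.singleton_mem
  refine HasLowerL1Estimate.containsL1SpreadingModel (z := fun n => (z n : X)) (fun E hE a => ?_)
    hc hC hF.absorbs_pairs hF.singleton_mem
  exact (hz E hE a).trans_eq
    (congrArg norm (show ((∑ i ∈ E, a i • z i : Y) : X) = ∑ i ∈ E, a i • (z i : X) by simp))

/-- Lifts of norm less than ‖z n‖ + 1 stay bounded, and the lower estimate lifts since the quotient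
map does not increase norms. -/
theorem ContainsL1SpreadingModel.of_quotient (hF : IsLayered F G) {Y : Submodule 𝕜 X}
    [IsClosed (Y : Set X)] (h : ContainsL1SpreadingModel 𝕜 (X ⧸ Y) F) :
    ContainsL1SpreadingModel 𝕜 X F := by
  obtain ⟨z, c, C, hc, hC, hz⟩ := h.exists_hasLowerL1Estimate hF.singleton_mem
  choose x hx hxz using fun n => Submodule.Quotient.norm_mk_lt (z n) one_pos
  refine HasLowerL1Estimate.containsL1SpreadingModel (z := x) (fun E hE a => ?_) hc
    (fun n => (hxz n).le.trans (add_le_add_left (hC n) 1)) hF.absorbs_pairs hF.singleton_mem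
  refine (hz E hE a).trans (le_trans (le_of_eq ?_) (Submodule.Quotient.norm_mk_le Y _))
  rw [← Submodule.mkQ_apply, map_sum]
  simp only [map_smul, Submodule.mkQ_apply, hx]

theorem ContainsL1SpreadingModel.submodule_or_quotient (hF : IsLayered F G) (Y : Submodule 𝕜 X)
    [IsClosed (Y : Set X)] (h : ContainsL1SpreadingModel 𝕜 X F) :
    ContainsL1SpreadingModel 𝕜 Y F ∨ ContainsL1SpreadingModel 𝕜 (X ⧸ Y) F := by
  obtain ⟨z, c, C, hc, hC, hz⟩ := h.exists_hasLowerL1Estimate hF.singleton_mem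
  -- Does a single layer contain, arbitrarily far out, normalised combinations within c/2 of Y?
  by_cases hA : ∃ n, ∀ m : ℕ+, ∃ E ∈ G n, (∀ i ∈ E, m ≤ i) ∧ ∃ a : ℕ+ → 𝕜,
      ∑ i ∈ E, ‖a i‖ = 1 ∧ ‖Y.mkQ (∑ i ∈ E, a i • z i)‖ < c / 2
  · left
    obtain ⟨n, hn⟩ := hA
    obtain ⟨g, hg⟩ := hF.absorbs n
    obtain ⟨B, hB, hBP, hgB⟩ := exists_isBlockSequence (P := fun E => E ∈ G n ∧ ∃ a : ℕ+ → 𝕜,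
      ∑ i ∈ E, ‖a i‖ = 1 ∧ ‖Y.mkQ (∑ i ∈ E, a i • z i)‖ < c / 2) (fun m => by
        obtain ⟨E, hE, hm, a, ha, h⟩ := hn m
        refine ⟨E, ?_, ⟨hE, a, ha, h⟩, hm⟩
        rw [Finset.nonempty_iff_ne_empty]
        rintro rfl
        simp at ha) g
    choose hBG a ha hY using hBP
    obtain ⟨y, hyC, hy⟩ := hz.exists_of_blocks_near hC hB
      (fun J hJ => hg J hJ B hB (fun j _ => hBG j) fun j _ => hgB j) ha hY
    exact hy.containsL1SpreadingModel (half_pos hc) hyC hF.absorbs_pairs hF.singleton_mem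
  · right
    push Not at hA
    obtain ⟨θ, hθ⟩ := HasLowerL1Estimate.exists_subseq_of_layers (𝕜 := 𝕜) (c := c / 2)
      (x := fun n => Y.mkQ (z n)) hF fun n => by
        obtain ⟨m, hm⟩ := hA n
        refine ⟨m, fun E hE hi a ha => ?_⟩
        have := hm E hE hi a ha
        simpa only [map_sum, map_smul] using this
    exact hθ.containsL1SpreadingModel (half_pos hc)
      (fun n => (Submodule.Quotient.norm_mk_le Y _).trans (hC _))
      hF.absorbs_pairs hF.singleton_mem

end ThreeSpace

theorem proposition4 (𝕜 : Type*) [RCLike 𝕜] (X : Type*) [NormedAddCommGroup X] [NormedSpace 𝕜 X]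
    [CompleteSpace X] (Y : Submodule 𝕜 X) [hY : IsClosed (Y : Set X)]
    (s : Ordinal.{0} → ℕ+ → Ordinal.{0}) (hs : IsLimitApproximation s)
    (ξ : Ordinal.{0}) (hξ : ξ < Ordinal.omega 1) :
    ContainsL1SpreadingModel 𝕜 X (schreier s (Ordinal.omega0 ^ ξ)) ↔
      (ContainsL1SpreadingModel 𝕜 Y (schreier s (Ordinal.omega0 ^ ξ)) ∨
        ContainsL1SpreadingModel 𝕜 (X ⧸ Y) (schreier s (Ordinal.omega0 ^ ξ))) := by
  obtain ⟨G, hG⟩ := exists_isLayered_schreier hs ξ hξ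
  exact ⟨fun h => h.submodule_or_quotient hG Y,
    fun h => h.elim (fun h => h.of_submodule hG) fun h => h.of_quotient hG⟩
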